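/- Let $k\ge 0$ be an integer, $p=2k+1$, $0<l<\infty$, $D=d/dx$. Let $J_k$ be the $k\times k$ matrix with entries $(J_k)_{r,\,k+1-r}=(-1)^{r-1}$ for $1\le r\le k$ and all other entries $0$. Let $W_2^p(0,l)$ be the set of functions $y\in L^2(0,l)$ that (after modification on a null set) are $p-1$ times continuously differentiable on $[0,l]$ with $y^{(p-1)}$ absolutely continuous and $y^{(p)}\in L^2(0,l)$. For such $y$ and $x\in[0,l]$ put $$Y_0(x)=\operatorname{col}\bigl(y(x),y'(x),\ldots,y^{(k-1)}(x)\bigr)\in\mathbb{C}^k,\qquad Y_1(x)=\operatorname{col}\bigl(y^{(k+1)}(x),y^{(k+2)}(x),\ldots,y^{(p-1)}(x)\bigr)\in\mathbb{C}^k.$$ **Proposition.** Let $\theta\in\mathbb{T}=\{z\in\mathbb{C}: |z|=1\}$ and let $B_0,B_l$ be arbitrary self-adjoint complex $k\times k$ matrices. Then the operator $y\mapsto(-iD)^p y=(-i)^p y^{(p)}$ in $L^2(0,l)$, whose domain is the set of all $y\in W_2^p(0,l)$ satisfying the boundary conditions $$y^{(k)}(l)=\theta\, y^{(k)}(0),\qquad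 J_kY_1(0)=iB_0Y_0(0),\qquad J_kY_1(l)=iB_lY_0(l),$$ is densely defined and self-adjoint. (For $k=0$ the last two conditions are void.) -/

import Mathlib

open MeasureTheory Set
open scoped Matrix

noncomputable section

namespace OddOrder

/-- The complex Hilbert space `L²(0, l)` with respect to Lebesgue measure. -/
abbrev L2 (l : ℝ) : Type := Lp ℂ 2 (volume.restrict (Ioo (0 : ℝ) l))

/-- The derivative `y⁽ʲ⁾(x)` of a function on the closed interval `[0, l]` (one-sided at the two
end points). -/
def dv (l : ℝ) (j : ℕ) (y : ℝ → ℂ) (x : ℝ) : ℂ := iteratedDerivWithin j y (Icc 0 l) x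

/-- `y` belongs to the Sobolev space `W₂ⁿ⁺¹(0, l)` and its derivative of order `n + 1` is `g`:
`y` is `n` times continuously differentiable on `[0, l]`, and `y⁽ⁿ⁾` is absolutely continuous with
almost everywhere derivative `g ∈ L²(0, l)`, that is, `y⁽ⁿ⁾` is an indefinite integral of `g`. -/
structure HasTopDeriv (l : ℝ) (n : ℕ) (y : ℝ → ℂ) (g : L2 l) : Prop where
  contDiffOn : ContDiffOn ℝ n y (Icc 0 l)
  eq_integral : ∀ x ∈ Icc (0 : ℝ) l, dv l n y x = dv l n y 0 + ∫ t in (0 : ℝ)..x, g t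

/-- The `k × k` matrix with entries `1, -1, …, (-1)ᵏ⁻¹` on the anti-diagonal, read from the top
right corner to the bottom left corner, and zeros elsewhere. -/
def J (k : ℕ) : Matrix (Fin k) (Fin k) ℂ :=
  Matrix.of fun r s => if (r : ℕ) + (s : ℕ) + 1 = k then (-1) ^ (r : ℕ) else 0

/-- `Y₀(x) = col (y(x), y'(x), …, y⁽ᵏ⁻¹⁾(x))`. -/
def Y0 (l : ℝ) (k : ℕ) (y : ℝ → ℂ) (x : ℝ) : Fin k → ℂ := fun r => dv l r y x

/-- `Y₁(x) = col (y⁽ᵏ⁺¹⁾(x), y⁽ᵏ⁺²⁾(x), …, y⁽²ᵏ⁾(x))`. -/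
def Y1 (l : ℝ) (k : ℕ) (y : ℝ → ℂ) (x : ℝ) : Fin k → ℂ := fun r => dv l (k + 1 + r) y x

/-- The boundary conditions
`y⁽ᵏ⁾(l) = θ y⁽ᵏ⁾(0)`, `Jₖ Y₁(0) = i B₀ Y₀(0)`, `Jₖ Y₁(l) = i Bₗ Y₀(l)`. -/
structure BoundaryConditions (l : ℝ) (k : ℕ) (θ : ℂ) (B₀ Bl : Matrix (Fin k) (Fin k) ℂ)
    (y : ℝ → ℂ) : Prop where
  middle : dv l k y l = θ * dv l k y 0
  left : J k *ᵥ Y1 l k y 0 = Complex.I • (B₀ *ᵥ Y0 l k y 0)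
  right : J k *ᵥ Y1 l k y l = Complex.I • (Bl *ᵥ Y0 l k y l)

lemma dv_zero (l : ℝ) (j : ℕ) (x : ℝ) : dv l j (0 : ℝ → ℂ) x = 0 := by
  simp [dv]

lemma dv_smul (l : ℝ) (j : ℕ) (c : ℂ) (y : ℝ → ℂ) (x : ℝ) :
    dv l j (c • y) x = c * dv l j y x := by
  simp [dv, iteratedDerivWithin_const_smul_field]

lemma dv_add {l : ℝ} (hl : 0 < l) {n j : ℕ} (hj : j ≤ n) {y z : ℝ → ℂ}
    (hy : ContDiffOn ℝ n y (Icc 0 l)) (hz : ContDiffOn ℝ n z (Icc 0 l)) {x : ℝ}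
    (hx : x ∈ Icc 0 l) : dv l j (y + z) x = dv l j y x + dv l j z x :=
  iteratedDerivWithin_add hx (uniqueDiffOn_Icc hl)
    ((hy x hx).of_le (by exact_mod_cast hj)) ((hz x hx).of_le (by exact_mod_cast hj))

lemma intervalIntegrable {l : ℝ} (g : L2 l) {x : ℝ} (hx : x ∈ Icc 0 l) :
    IntervalIntegrable g volume 0 x := by
  have h : Integrable g (volume.restrict (Ioo 0 l)) := (Lp.memLp g).integrable (by norm_num)
  rw [intervalIntegrable_iff_integrableOn_Ioo_of_le hx.1]
  exact IntegrableOn.mono_set h (Ioo_subset_Ioo_right hx.2)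

lemma integral_congr {l : ℝ} {g h : ℝ → ℂ} (hgh : g =ᵐ[volume.restrict (Ioo 0 l)] h) {x : ℝ}
    (hx : x ∈ Icc 0 l) : ∫ t in (0 : ℝ)..x, g t = ∫ t in (0 : ℝ)..x, h t := by
  rw [intervalIntegral.integral_of_le hx.1, intervalIntegral.integral_of_le hx.1,
    integral_Ioc_eq_integral_Ioo, integral_Ioc_eq_integral_Ioo]
  exact integral_congr_ae (ae_restrict_of_ae_restrict_of_subset (Ioo_subset_Ioo_right hx.2) hgh)

/-- The graph of the operator `(-iD)ᵖ`, `p = 2k + 1`, in `L²(0, l)`: the pairs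
`(y, (-i)ᵖ y⁽ᵖ⁾)` in which `y` runs through the functions from `W₂ᵖ(0, l)` that satisfy the boundary
conditions. -/
def operatorGraph {l : ℝ} (hl : 0 < l) (k : ℕ) (θ : ℂ) (B₀ Bl : Matrix (Fin k) (Fin k) ℂ) :
    Submodule ℂ (L2 l × L2 l) where
  carrier := {q | ∃ (y : ℝ → ℂ) (g : L2 l), HasTopDeriv l (2 * k) y g ∧
    BoundaryConditions l k θ B₀ Bl y ∧ q.1 =ᵐ[volume.restrict (Ioo 0 l)] y ∧
    q.2 = ((-Complex.I) ^ (2 * k + 1)) • g}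
  zero_mem' := by
    refine ⟨0, 0, ⟨contDiffOn_const, fun x hx => ?_⟩, ⟨?_, ?_, ?_⟩, Lp.coeFn_zero _ _ _, by simp⟩
    · rw [integral_congr (Lp.coeFn_zero _ _ _) hx]
      simp [dv_zero]
    · simp [dv_zero]
    all_goals
      have h0 : ∀ x, Y0 l k 0 x = 0 := fun x => funext fun r => dv_zero l r x
      have h1 : ∀ x, Y1 l k 0 x = 0 := fun x => funext fun r => dv_zero l _ x
      simp [h0, h1]
  add_mem' := by
    rintro ⟨f₁, h₁⟩ ⟨f₂, h₂⟩ ⟨y₁, g₁, d₁, b₁, e₁, rfl⟩ ⟨y₂, g₂, d₂, b₂, e₂, rfl⟩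
    have m0 : (0 : ℝ) ∈ Icc 0 l := ⟨le_rfl, hl.le⟩
    have ml : l ∈ Icc 0 l := ⟨hl.le, le_rfl⟩
    have key : ∀ {j : ℕ}, j ≤ 2 * k → ∀ {x : ℝ}, x ∈ Icc 0 l →
        dv l j (y₁ + y₂) x = dv l j y₁ x + dv l j y₂ x :=
      fun hj _ hx => dv_add hl hj d₁.contDiffOn d₂.contDiffOn hx
    have k0 : ∀ {x : ℝ}, x ∈ Icc 0 l → Y0 l k (y₁ + y₂) x = Y0 l k y₁ x + Y0 l k y₂ x :=
      fun hx => funext fun r => key (by omega) hx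
    have k1 : ∀ {x : ℝ}, x ∈ Icc 0 l → Y1 l k (y₁ + y₂) x = Y1 l k y₁ x + Y1 l k y₂ x :=
      fun hx => funext fun r => key (by omega) hx
    refine ⟨y₁ + y₂, g₁ + g₂, ⟨d₁.contDiffOn.add d₂.contDiffOn, fun x hx => ?_⟩, ⟨?_, ?_, ?_⟩,
      (Lp.coeFn_add _ _).trans (e₁.add e₂), by simp [smul_add]⟩
    · rw [integral_congr (Lp.coeFn_add g₁ g₂) hx, key le_rfl hx, key le_rfl m0,
        d₁.eq_integral x hx, d₂.eq_integral x hx]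
      simp only [Pi.add_apply]
      rw [intervalIntegral.integral_add (intervalIntegrable g₁ hx) (intervalIntegrable g₂ hx)]
      ring
    · rw [key (by omega) ml, key (by omega) m0, b₁.middle, b₂.middle, mul_add]
    · rw [k0 m0, k1 m0, Matrix.mulVec_add, Matrix.mulVec_add, b₁.left, b₂.left, smul_add]
    · rw [k0 ml, k1 ml, Matrix.mulVec_add, Matrix.mulVec_add, b₁.right, b₂.right, smul_add]
  smul_mem' := by
    rintro c ⟨f, h⟩ ⟨y, g, d, b, e, rfl⟩
    have k0 : ∀ x : ℝ, Y0 l k (c • y) x = c • Y0 l k y x :=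
      fun x => funext fun r => dv_smul l r c y x
    have k1 : ∀ x : ℝ, Y1 l k (c • y) x = c • Y1 l k y x :=
      fun x => funext fun r => dv_smul l _ c y x
    refine ⟨c • y, c • g, ⟨d.contDiffOn.const_smul c, fun x hx => ?_⟩, ⟨?_, ?_, ?_⟩,
      (Lp.coeFn_smul _ _).trans (e.const_smul c), smul_comm _ _ _⟩
    · rw [integral_congr (Lp.coeFn_smul c g) hx, dv_smul, dv_smul, d.eq_integral x hx]
      simp [mul_add]
    · rw [dv_smul, dv_smul, b.middle]
      ring
    · rw [k0, k1, Matrix.mulVec_smul, Matrix.mulVec_smul, b.left, smul_comm]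
    · rw [k0, k1, Matrix.mulVec_smul, Matrix.mulVec_smul, b.right, smul_comm]

/-- The graph is single valued. -/
lemma operatorGraph_single_valued {l : ℝ} (hl : 0 < l) (k : ℕ) (θ : ℂ)
    (B₀ Bl : Matrix (Fin k) (Fin k) ℂ) (q : L2 l × L2 l)
    (hq : q ∈ operatorGraph hl k θ B₀ Bl) (hq0 : q.1 = 0) : q.2 = 0 := by
  obtain ⟨f, h⟩ := q
  obtain ⟨y, g, d, -, e, hh⟩ := hq
  simp only at hq0 hh e
  subst hq0
  have hy : y =ᵐ[volume.restrict (Ioo 0 l)] 0 :=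
    e.symm.trans (Lp.coeFn_zero _ _ _)
  have hyo : EqOn y 0 (Ioo 0 l) :=
    Measure.eqOn_open_of_ae_eq hy isOpen_Ioo (d.contDiffOn.continuousOn.mono Ioo_subset_Icc_self)
      continuousOn_const
  have hyc : EqOn y 0 (Icc 0 l) :=
    hyo.of_subset_closure d.contDiffOn.continuousOn continuousOn_const Ioo_subset_Icc_self
      (by rw [closure_Ioo hl.ne])
  have hdv : ∀ x ∈ Icc 0 l, dv l (2 * k) y x = 0 := fun x hx =>
    (iteratedDerivWithin_congr hyc hx).trans (dv_zero l (2 * k) x)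
  have hint : ∀ x ∈ Icc 0 l, ∫ t in (0 : ℝ)..x, g t = 0 := fun x hx => by
    simpa [hdv x hx, hdv 0 ⟨le_rfl, hl.le⟩] using (d.eq_integral x hx).symm
  have hg : g = 0 := by
    rw [Lp.eq_zero_iff_ae_eq_zero]
    have hae := (intervalIntegrable g ⟨hl.le, le_rfl⟩).ae_hasDerivAt_integral
    filter_upwards [ae_restrict_of_ae hae, ae_restrict_mem measurableSet_Ioo] with x hx hxm
    have hx' := hx (by rw [uIcc_of_le hl.le]; exact Ioo_subset_Icc_self hxm) 0
      (by rw [uIcc_of_le hl.le]; exact ⟨le_rfl, hl.le⟩)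
    have h0 : HasDerivAt (fun u : ℝ => ∫ t in (0 : ℝ)..u, g t) 0 x := by
      refine (hasDerivAt_const x (0 : ℂ)).congr_of_eventuallyEq ?_
      filter_upwards [isOpen_Ioo.mem_nhds hxm] with u hu
      exact hint u (Ioo_subset_Icc_self hu)
    exact hx'.unique h0
  simp [hh, hg]

/-- The (unbounded) operator `(-iD)ᵖ`, `p = 2k + 1`, in `L²(0, l)`, whose domain consists of the
functions `y ∈ W₂ᵖ(0, l)` satisfying the boundary conditions. -/
def operator {l : ℝ} (hl : 0 < l) (k : ℕ) (θ : ℂ) (B₀ Bl : Matrix (Fin k) (Fin k) ℂ) :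
    L2 l →ₗ.[ℂ] L2 l :=
  (operatorGraph hl k θ B₀ Bl).toLinearPMap

lemma operator_graph {l : ℝ} (hl : 0 < l) (k : ℕ) (θ : ℂ)
    (B₀ Bl : Matrix (Fin k) (Fin k) ℂ) :
    (operator hl k θ B₀ Bl).graph = operatorGraph hl k θ B₀ Bl :=
  Submodule.toLinearPMap_graph_eq _ (operatorGraph_single_valued hl k θ B₀ Bl)

end OddOrder

end

noncomputable section

namespace OddOrder

/-! Integrating by parts `2k + 1` times gives Green's formula (`HasTopDeriv.inner_green`): for `y`,
`z` with top derivatives `g`, `h`, the sum `⟨z, g⟩ + ⟨h, y⟩` is the difference of the boundary form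
`bdry` at `l` and at `0`. In terms of the boundary vectors (`bdry_eq`) this form is `JY₁(y)·conj
Y₀(z) + (-1)ᵏ y⁽ᵏ⁾ conj z⁽ᵏ⁾ + Y₀(y)·conj JY₁(z)`. If `y` and `z` satisfy the boundary conditions,
the outer terms cancel at each end because `B₀`, `Bl` are Hermitian, and the middle terms at the two
ends agree because `|θ| = 1`. As `(-i)ᵖ` is purely imaginary, the operator is symmetric.

Conversely, let `(Z, W)` lie in the adjoint relation, put `h = (-i)⁻ᵖ W`, and let `z₀` have top
derivative `h`. Every `g` orthogonal to the polynomials of degree at most `2k` is the top derivative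
of some `y` with zero boundary data (`exists_hasTopDeriv_of_mem_orthogonal`). Testing against these
`y` shows that `Z - z₀` is orthogonal to all such `g`, hence is itself such a polynomial. So `Z` is
in `W₂ᵖ` with top derivative `h`, and its boundary form against the domain is the same at both ends.
Hermite interpolation realises all boundary data, which forces the boundary conditions on `Z`
(`boundaryConditions_of_bdry`).

Density follows from the equality of the graph with its adjoint relation. -/

/-! ### Absolute continuity and integration by parts. -/

lemma absolutelyContinuousOnInterval_primitive {a b : ℝ} {f : ℝ → ℂ}
    (hf : IntervalIntegrable f volume a b) :
    AbsolutelyContinuousOnInterval (fun x => ∫ t in a..x, f t) a b := by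
  have hre : IntervalIntegrable (fun t => (f t).re) volume a b :=
    ⟨hf.1.re, hf.2.re⟩
  have him : IntervalIntegrable (fun t => (f t).im) volume a b :=
    ⟨hf.1.im, hf.2.im⟩
  have hc : ∀ c : ℂ, AbsolutelyContinuousOnInterval (fun _ : ℝ => c) a b := fun c =>
    contDiffOn_const.absolutelyContinuousOnInterval
  have h := ((hre.absolutelyContinuousOnInterval_intervalIntegral left_mem_uIcc).smul (hc 1)).add
    ((him.absolutelyContinuousOnInterval_intervalIntegral left_mem_uIcc).smul (hc Complex.I))
  -- The primitive equals the combination of its real and imaginary parts only on `uIcc a b`, so the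
  -- transfer is made at the level of `ε` and `δ`.
  rw [absolutelyContinuousOnInterval_iff] at h ⊢
  intro ε hε
  obtain ⟨δ, hδ, H⟩ := h ε hε
  refine ⟨δ, hδ, fun E hE hlt => ?_⟩
  have key : ∀ x ∈ uIcc a b, ∫ t in a..x, f t =
      ((fun x => ∫ t in a..x, (f t).re) • (fun _ : ℝ => (1 : ℂ)) +
        (fun x => ∫ t in a..x, (f t).im) • (fun _ : ℝ => Complex.I)) x := by
    intro x hx
    have hfx : IntervalIntegrable f volume a x :=
      hf.mono_set (uIcc_subset_uIcc left_mem_uIcc hx)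
    have h1 := Complex.reCLM.intervalIntegral_comp_comm hfx
    have h2 := Complex.imCLM.intervalIntegral_comp_comm hfx
    simp only [Complex.reCLM_apply, Complex.imCLM_apply] at h1 h2
    simp only [Pi.add_apply, Pi.smul_apply', h1, h2, Complex.real_smul, mul_one]
    exact (Complex.re_add_im _).symm
  refine lt_of_eq_of_lt (Finset.sum_congr rfl fun i hi => ?_) (H E hE hlt)
  have hm := hE.1 i hi
  rw [key _ hm.1, key _ hm.2]

lemma AbsolutelyContinuousOnInterval.eq_of_ae_hasDerivAt_zero {a b : ℝ} {F : ℝ → ℂ}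
    (hF : AbsolutelyContinuousOnInterval F a b)
    (h0 : ∀ᵐ x, x ∈ uIcc a b → HasDerivAt F 0 x) : F b = F a := by
  obtain ⟨C, hC⟩ := hF.const_of_ae_hasDerivAt_zero h0
  rw [hC b right_mem_uIcc, hC a left_mem_uIcc]

/-- Integration by parts for complex indefinite integrals. -/
lemma integral_mul_add_mul_of_primitive {a b : ℝ} {u u' v v' : ℝ → ℂ}
    (hu' : IntervalIntegrable u' volume a b) (hv' : IntervalIntegrable v' volume a b)
    (hu : ∀ x ∈ uIcc a b, u x = u a + ∫ t in a..x, u' t)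
    (hv : ∀ x ∈ uIcc a b, v x = v a + ∫ t in a..x, v' t) :
    (∫ t in a..b, u' t * v t) + (∫ t in a..b, u t * v' t) = u b * v b - u a * v a := by
  have cont : ∀ {w w' : ℝ → ℂ}, IntervalIntegrable w' volume a b →
      (∀ x ∈ uIcc a b, w x = w a + ∫ t in a..x, w' t) → ContinuousOn w (uIcc a b) :=
    fun hw' hw => (continuousOn_const.add (intervalIntegral.continuousOn_primitive_interval
      ((intervalIntegrable_iff').1 hw'))).congr hw
  have hcu := cont hu' hu
  have hcv := cont hv' hv
  have i1 : IntervalIntegrable (fun t => u' t * v t) volume a b := hu'.mul_continuousOn hcv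
  have i2 : IntervalIntegrable (fun t => u t * v' t) volume a b := hv'.continuousOn_mul hcu
  have hc : ∀ c : ℂ, AbsolutelyContinuousOnInterval (fun _ : ℝ => c) a b := fun c =>
    contDiffOn_const.absolutelyContinuousOnInterval
  -- `u` and `v` are controlled only on the interval; `U` and `V` are extensions that have
  -- derivatives almost everywhere on it. Then `UV - W` is absolutely continuous with derivative
  -- zero almost everywhere, hence has equal values at `a` and `b`.
  set U : ℝ → ℂ := (fun _ => u a) + fun x => ∫ t in a..x, u' t
  set V : ℝ → ℂ := (fun _ => v a) + fun x => ∫ t in a..x, v' t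
  set W : ℝ → ℂ := fun x => ∫ t in a..x, (u' t * v t + u t * v' t)
  have acU : AbsolutelyContinuousOnInterval U a b :=
    (hc _).add (absolutelyContinuousOnInterval_primitive hu')
  have acV : AbsolutelyContinuousOnInterval V a b :=
    (hc _).add (absolutelyContinuousOnInterval_primitive hv')
  have acW : AbsolutelyContinuousOnInterval W a b :=
    absolutelyContinuousOnInterval_primitive (i1.add i2)
  have h := AbsolutelyContinuousOnInterval.eq_of_ae_hasDerivAt_zero
    ((acU.smul acV).sub acW) ?_
  · have eU : U b = u b := (hu b right_mem_uIcc).symm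
    have eV : V b = v b := (hv b right_mem_uIcc).symm
    have eU' : U a = u a := (hu a left_mem_uIcc).symm
    have eV' : V a = v a := (hv a left_mem_uIcc).symm
    have eW : W a = 0 := intervalIntegral.integral_same
    have eW' : W b = (∫ t in a..b, u' t * v t) + (∫ t in a..b, u t * v' t) :=
      intervalIntegral.integral_add i1 i2
    simp only [Pi.sub_apply, smul_eq_mul, Pi.mul_apply, eU, eV, eU', eV', eW] at h
    rw [← eW']
    linear_combination -h
  · filter_upwards [hu'.ae_hasDerivAt_integral, hv'.ae_hasDerivAt_integral,
      (i1.add i2).ae_hasDerivAt_integral] with x h1 h2 h3 hx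
    have d1 : HasDerivAt U (u' x) x := by
      simpa using (hasDerivAt_const x (u a)).add (h1 hx a left_mem_uIcc)
    have d2 : HasDerivAt V (v' x) x := by
      simpa using (hasDerivAt_const x (v a)).add (h2 hx a left_mem_uIcc)
    have d3 : HasDerivAt W (u' x * v x + u x * v' x) x := h3 hx a left_mem_uIcc
    have d := (d1.mul d2).sub d3
    have eU : U x = u x := (hu x hx).symm
    have eV : V x = v x := (hv x hx).symm
    rw [eU, eV, sub_self] at d
    exact d

/-! ### Derivatives up to the top order and Green's formula. -/

/-- The derivative of order `j` of a function in `W₂ⁿ⁺¹` with top derivative `g`. -/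
def jet (l : ℝ) (n : ℕ) (y : ℝ → ℂ) (g : L2 l) (j : ℕ) : ℝ → ℂ :=
  if j ≤ n then dv l j y else g

lemma continuousOn_dv {l : ℝ} (hl : 0 < l) {n j : ℕ} {y : ℝ → ℂ}
    (hy : ContDiffOn ℝ n y (Icc 0 l)) (hj : j ≤ n) : ContinuousOn (dv l j y) (Icc 0 l) :=
  hy.continuousOn_iteratedDerivWithin (by exact_mod_cast hj) (uniqueDiffOn_Icc hl)

lemma hasDerivWithinAt_dv {l : ℝ} (hl : 0 < l) {n j : ℕ} {y : ℝ → ℂ}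
    (hy : ContDiffOn ℝ n y (Icc 0 l)) (hj : j < n) {x : ℝ} (hx : x ∈ Icc 0 l) :
    HasDerivWithinAt (dv l j y) (dv l (j + 1) y x) (Icc 0 l) x := by
  have h := (hy.differentiableOn_iteratedDerivWithin (m := j) (by exact_mod_cast hj)
    (uniqueDiffOn_Icc hl) x hx).hasDerivWithinAt
  have e : dv l (j + 1) y x = derivWithin (dv l j y) (Icc 0 l) x :=
    congrFun iteratedDerivWithin_succ x
  rw [e]
  exact h

namespace HasTopDeriv

variable {l : ℝ} {n : ℕ} {y : ℝ → ℂ} {g : L2 l}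

lemma intervalIntegrable_jet (h : HasTopDeriv l n y g) (hl : 0 < l) (j : ℕ) :
    IntervalIntegrable (jet l n y g j) volume 0 l := by
  unfold jet
  split_ifs with hj
  · refine ContinuousOn.intervalIntegrable ?_
    rw [uIcc_of_le hl.le]
    exact continuousOn_dv hl h.contDiffOn hj
  · exact intervalIntegrable g ⟨hl.le, le_rfl⟩

lemma jet_eq_integral (h : HasTopDeriv l n y g) (hl : 0 < l) {j : ℕ} (hj : j ≤ n) {x : ℝ}
    (hx : x ∈ Icc 0 l) :
    jet l n y g j x = jet l n y g j 0 + ∫ t in (0 : ℝ)..x, jet l n y g (j + 1) t := by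
  rcases hj.lt_or_eq with hj' | rfl
  · have hs : Icc 0 x ⊆ Icc 0 l := Icc_subset_Icc_right hx.2
    rw [jet, jet, if_pos hj, if_pos (Nat.succ_le_of_lt hj')]
    rw [intervalIntegral.integral_eq_sub_of_hasDerivAt_of_le hx.1
      ((continuousOn_dv hl h.contDiffOn hj).mono hs)]
    · ring
    · intro t ht
      have ht' : t ∈ Ioo 0 l := ⟨ht.1, ht.2.trans_le hx.2⟩
      exact (hasDerivWithinAt_dv hl h.contDiffOn hj' (Ioo_subset_Icc_self ht')).hasDerivAt
        (Icc_mem_nhds ht'.1 ht'.2)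
    · refine ContinuousOn.intervalIntegrable ?_
      rw [uIcc_of_le hx.1]
      exact (continuousOn_dv hl h.contDiffOn hj').mono hs
  · rw [jet, jet, if_pos le_rfl, if_neg (by omega)]
    exact h.eq_integral x hx

end HasTopDeriv

/-- The boundary form at the point `x` associated with a derivative of order `n + 1`. -/
def bdry (l : ℝ) (n : ℕ) (y z : ℝ → ℂ) (x : ℝ) : ℂ :=
  ∑ j ∈ Finset.range (n + 1), (-1) ^ j * (dv l (n - j) y x * star (dv l j z x))

/-- Telescoping. One integration by parts evaluates `I j + I (j + 1)`; the alternating sum leaves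
only the two extreme integrals, which are those of Green's formula. -/
lemma sum_alternating_add_succ (I : ℕ → ℂ) (n : ℕ) :
    ∑ j ∈ Finset.range (n + 1), (-1) ^ j * (I j + I (j + 1)) = I 0 + (-1) ^ n * I (n + 1) := by
  induction n with
  | zero => simp
  | succ n ih =>
    rw [Finset.sum_range_succ, ih]
    ring

/-- Green's formula. -/
lemma HasTopDeriv.integral_green {l : ℝ} (hl : 0 < l) {n : ℕ} {y z : ℝ → ℂ} {g h : L2 l}
    (hy : HasTopDeriv l n y g) (hz : HasTopDeriv l n z h) :
    (∫ t in (0 : ℝ)..l, g t * star (z t)) + (-1) ^ n * ∫ t in (0 : ℝ)..l, y t * star (h t) =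
      bdry l n y z l - bdry l n y z 0 := by
  let I : ℕ → ℂ := fun j =>
    ∫ t in (0 : ℝ)..l, jet l n y g (n + 1 - j) t * star (jet l n z h j t)
  have parts : ∀ j ∈ Finset.range (n + 1), (-1) ^ j * (I j + I (j + 1)) =
      (-1) ^ j * (dv l (n - j) y l * star (dv l j z l)) -
        (-1) ^ j * (dv l (n - j) y 0 * star (dv l j z 0)) := by
    intro j hj
    have hj : j ≤ n := Nat.lt_succ_iff.1 (Finset.mem_range.1 hj)
    have H := integral_mul_add_mul_of_primitive (a := 0) (b := l) (u := jet l n y g (n - j))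
      (u' := jet l n y g (n - j + 1)) (v := fun t => star (jet l n z h j t))
      (v' := fun t => star (jet l n z h (j + 1) t))
      (hy.intervalIntegrable_jet hl _)
      ⟨Complex.conjCLE.toContinuousLinearMap.integrable_comp (hz.intervalIntegrable_jet hl _).1,
        Complex.conjCLE.toContinuousLinearMap.integrable_comp (hz.intervalIntegrable_jet hl _).2⟩
      (fun x hx => hy.jet_eq_integral hl (by omega) (by rwa [uIcc_of_le hl.le] at hx))
      (fun x hx => by
        rw [uIcc_of_le hl.le] at hx
        rw [hz.jet_eq_integral hl hj hx, star_add]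
        congr 1
        rw [intervalIntegral.integral_of_le hx.1, intervalIntegral.integral_of_le hx.1]
        exact integral_conj.symm)
    have e1 : n + 1 - j = n - j + 1 := by omega
    have e2 : n + 1 - (j + 1) = n - j := by omega
    have e3 : I j + I (j + 1) = dv l (n - j) y l * star (dv l j z l) -
        dv l (n - j) y 0 * star (dv l j z 0) := by
      simp only [I, e1, e2]
      rw [H]
      simp only [jet, if_pos hj, if_pos (Nat.sub_le n j)]
    rw [e3, mul_sub]
  have h1 := sum_alternating_add_succ I n
  rw [Finset.sum_congr rfl parts, Finset.sum_sub_distrib] at h1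
  unfold bdry
  rw [h1]
  congr 2
  · simp [jet, dv]
  · simp [I, jet, dv]

lemma inner_eq_intervalIntegral {l : ℝ} (hl : 0 < l) (f g : L2 l) {u v : ℝ → ℂ}
    (hu : f =ᵐ[volume.restrict (Ioo 0 l)] u) (hv : g =ᵐ[volume.restrict (Ioo 0 l)] v) :
    inner ℂ f g = ∫ t in (0 : ℝ)..l, v t * star (u t) := by
  rw [L2.inner_def, intervalIntegral.integral_of_le hl.le, integral_Ioc_eq_integral_Ioo]
  refine integral_congr_ae ?_
  filter_upwards [hu, hv] with t h1 h2
  simp only [h1, h2, RCLike.inner_apply]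
  rfl

/-- Since `2k` is even, the sign `(-1)ⁿ` is `+1`: up to boundary terms, differentiation of odd order
is skew-adjoint. -/
lemma HasTopDeriv.inner_green {l : ℝ} (hl : 0 < l) {k : ℕ} {y z : ℝ → ℂ} {g h Y Z : L2 l}
    (hy : HasTopDeriv l (2 * k) y g) (hz : HasTopDeriv l (2 * k) z h)
    (eY : Y =ᵐ[volume.restrict (Ioo 0 l)] y) (eZ : Z =ᵐ[volume.restrict (Ioo 0 l)] z) :
    inner ℂ Z g + inner ℂ h Y = bdry l (2 * k) y z l - bdry l (2 * k) y z 0 := by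
  have H := hy.integral_green hl hz
  rw [pow_mul, neg_one_sq, one_pow, one_mul] at H
  rw [← H, inner_eq_intervalIntegral hl Z g eZ (Filter.EventuallyEq.refl _ _),
    inner_eq_intervalIntegral hl h Y (Filter.EventuallyEq.refl _ _) eY]

/-! ### Functions with prescribed top derivative. -/

lemma memLp_of_continuousOn {l : ℝ} {y : ℝ → ℂ} (hy : ContinuousOn y (Icc 0 l)) :
    MemLp y 2 (volume.restrict (Ioo 0 l)) := by
  obtain ⟨C, hC⟩ := isCompact_Icc.exists_bound_of_continuousOn hy
  refine MemLp.of_bound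
    ((hy.mono Ioo_subset_Icc_self).aestronglyMeasurable measurableSet_Ioo) C ?_
  filter_upwards [ae_restrict_mem measurableSet_Ioo] with x hx
  exact hC x (Ioo_subset_Icc_self hx)

/-- Splits off the innermost derivative, so that inductions on the order can replace a function by
its derivative. -/
lemma dv_succ_of_hasDerivWithinAt {l : ℝ} (hl : 0 < l) {y w : ℝ → ℂ}
    (h : ∀ x ∈ Icc 0 l, HasDerivWithinAt w (y x) (Icc 0 l) x) (j : ℕ) {x : ℝ}
    (hx : x ∈ Icc 0 l) : dv l (j + 1) w x = dv l j y x := by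
  have e : EqOn (derivWithin w (Icc 0 l)) y (Icc 0 l) := fun t ht =>
    (h t ht).derivWithin (uniqueDiffOn_Icc hl t ht)
  unfold dv
  rw [iteratedDerivWithin_succ']
  exact iteratedDerivWithin_congr e hx

lemma HasTopDeriv.succ {l : ℝ} (hl : 0 < l) {n : ℕ} {y w : ℝ → ℂ} {g : L2 l}
    (hy : HasTopDeriv l n y g) (h : ∀ x ∈ Icc 0 l, HasDerivWithinAt w (y x) (Icc 0 l) x) :
    HasTopDeriv l (n + 1) w g := by
  have e : EqOn (derivWithin w (Icc 0 l)) y (Icc 0 l) := fun t ht =>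
    (h t ht).derivWithin (uniqueDiffOn_Icc hl t ht)
  refine ⟨?_, fun x hx => ?_⟩
  · have : ((n + 1 : ℕ) : WithTop ℕ∞) = (n : WithTop ℕ∞) + 1 := by push_cast; rfl
    rw [this, contDiffOn_succ_iff_derivWithin (uniqueDiffOn_Icc hl)]
    exact ⟨fun x hx => (h x hx).differentiableWithinAt, fun hn => by simp at hn,
      hy.contDiffOn.congr e⟩
  · rw [dv_succ_of_hasDerivWithinAt hl h n hx,
      dv_succ_of_hasDerivWithinAt hl h n ⟨le_rfl, hl.le⟩]
    exact hy.eq_integral x hx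

lemma hasDerivWithinAt_primitive {l : ℝ} {y : ℝ → ℂ}
    (hy : ContinuousOn y (Icc 0 l)) {x : ℝ} (hx : x ∈ Icc 0 l) :
    HasDerivWithinAt (fun u => ∫ t in (0 : ℝ)..u, y t) (y x) (Icc 0 l) x := by
  -- The `FTCFilter` instance for one-sided neighbourhoods in `Icc 0 l` needs this `Fact`.
  have : Fact (x ∈ Icc 0 l) := ⟨hx⟩
  refine intervalIntegral.integral_hasDerivWithinAt_right ?_
    (hy.stronglyMeasurableAtFilter_nhdsWithin measurableSet_Icc x) (hy x hx)
  refine ContinuousOn.intervalIntegrable (hy.mono ?_)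
  rw [uIcc_of_le hx.1]
  exact Icc_subset_Icc_right hx.2

/-- Every `g ∈ L²(0, l)` is the top derivative of a function with vanishing initial data. -/
lemma exists_hasTopDeriv {l : ℝ} (hl : 0 < l) (n : ℕ) (g : L2 l) :
    ∃ y, HasTopDeriv l n y g ∧ ∀ j ≤ n, dv l j y 0 = 0 := by
  have m0 : (0 : ℝ) ∈ Icc 0 l := ⟨le_rfl, hl.le⟩
  induction n with
  | zero =>
    refine ⟨fun x => ∫ t in (0 : ℝ)..x, g t, ⟨?_, fun x hx => ?_⟩, fun j hj => ?_⟩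
    · have := intervalIntegral.continuousOn_primitive_interval
        ((intervalIntegrable_iff').1 (intervalIntegrable g (x := l) ⟨hl.le, le_rfl⟩))
      rw [uIcc_of_le hl.le] at this
      simpa using this
    · simp [dv]
    · obtain rfl : j = 0 := by omega
      simp [dv]
  | succ n ih =>
    obtain ⟨y, hy, h0⟩ := ih
    have hd := fun x (hx : x ∈ Icc 0 l) =>
      hasDerivWithinAt_primitive hy.contDiffOn.continuousOn hx
    refine ⟨fun x => ∫ t in (0 : ℝ)..x, y t, hy.succ hl hd, fun j hj => ?_⟩
    cases j with
    | zero => simp [dv]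
    | succ j => rw [dv_succ_of_hasDerivWithinAt hl hd j m0, h0 j (by omega)]

/-! ### Polynomials and Hermite interpolation. -/

/-- The function on the line given by a complex polynomial. -/
def polyFun (P : Polynomial ℂ) (x : ℝ) : ℂ := P.eval (x : ℂ)

lemma hasDerivAt_polyFun (P : Polynomial ℂ) (x : ℝ) :
    HasDerivAt (polyFun P) (polyFun P.derivative x) x :=
  (P.hasDerivAt (x : ℂ)).comp_ofReal

lemma continuous_polyFun (P : Polynomial ℂ) : Continuous (polyFun P) :=
  P.continuous.comp Complex.continuous_ofReal

lemma dv_polyFun {l : ℝ} (hl : 0 < l) (j : ℕ) (P : Polynomial ℂ) {x : ℝ} (hx : x ∈ Icc 0 l) :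
    dv l j (polyFun P) x = polyFun (Polynomial.derivative^[j] P) x := by
  induction j generalizing P with
  | zero => simp [dv]
  | succ j ih =>
    rw [dv_succ_of_hasDerivWithinAt hl (fun t _ => (hasDerivAt_polyFun P t).hasDerivWithinAt) j hx,
      ih, Function.iterate_succ_apply]

/-- The class in `L²(0, l)` of a complex polynomial. -/
def polyL2 (l : ℝ) : Polynomial ℂ →ₗ[ℂ] L2 l where
  toFun P := (memLp_of_continuousOn (l := l) (continuous_polyFun P).continuousOn).toLp
  map_add' P Q := by
    rw [← MemLp.toLp_add]
    congr 1
    funext x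
    simp [polyFun]
  map_smul' c P := by
    rw [RingHom.id_apply, ← MemLp.toLp_const_smul]
    congr 1
    funext x
    simp [polyFun]

lemma coeFn_polyL2 (l : ℝ) (P : Polynomial ℂ) :
    polyL2 l P =ᵐ[volume.restrict (Ioo 0 l)] polyFun P :=
  (memLp_of_continuousOn (continuous_polyFun P).continuousOn).coeFn_toLp

lemma hasTopDeriv_polyFun {l : ℝ} (hl : 0 < l) (n : ℕ) (P : Polynomial ℂ) :
    HasTopDeriv l n (polyFun P) (polyL2 l (Polynomial.derivative^[n + 1] P)) := by
  induction n generalizing P with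
  | zero =>
    refine ⟨?_, fun x hx => ?_⟩
    · simpa using (continuous_polyFun P).continuousOn
    · rw [integral_congr (coeFn_polyL2 l _) hx]
      simp only [dv, iteratedDerivWithin_zero, zero_add, Function.iterate_one]
      rw [intervalIntegral.integral_eq_sub_of_hasDerivAt (fun t _ => hasDerivAt_polyFun P t)
        ((continuous_polyFun _).intervalIntegrable _ _)]
      ring
  | succ n ih =>
    rw [Function.iterate_succ_apply]
    exact (ih P.derivative).succ hl fun t _ => (hasDerivAt_polyFun P t).hasDerivWithinAt

open Polynomial in
-- The Taylor polynomial with coefficients `α i / i!`, recentred at `a`. The degree bound is what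
-- later makes its top derivative vanish.
lemma exists_polynomial_jet (a : ℂ) (α : ℕ → ℂ) (n : ℕ) :
    ∃ P : ℂ[X], P.degree < n ∧ ∀ j < n, (derivative^[j] P).eval a = α j := by
  let Q : ℂ[X] := ∑ i ∈ Finset.range n, C (α i / (i.factorial : ℂ)) * X ^ i
  have hQ : Q.degree < n := by
    refine (degree_sum_le _ _).trans_lt ((Finset.sup_lt_iff (by simp)).2 fun i hi => ?_)
    exact (degree_C_mul_X_pow_le i _).trans_lt (by exact_mod_cast Finset.mem_range.1 hi)
  refine ⟨taylor (-a) Q, by rwa [degree_taylor], fun j hj => ?_⟩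
  rw [← factorial_smul_hasseDeriv, LinearMap.smul_apply, eval_smul, ← taylor_coeff, taylor_taylor]
  simp only [add_neg_cancel, taylor_zero, Q, finsetSum_coeff, coeff_C_mul_X_pow]
  rw [Finset.sum_eq_single j]
  · rw [if_pos rfl, nsmul_eq_mul, mul_div_cancel₀]
    exact_mod_cast j.factorial_ne_zero
  · intro i _ hij
    rw [if_neg hij.symm]
  · intro h
    exact absurd (Finset.mem_range.2 hj) h

open Polynomial in
lemma eval_iterate_derivative_eq_of_pow_dvd {a : ℂ} {n j : ℕ} (hj : j < n) {P Q : ℂ[X]}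
    (h : (X - C a) ^ n ∣ P - Q) : (derivative^[j] P).eval a = (derivative^[j] Q).eval a := by
  have h1 : (X - C a) ∣ derivative^[j] (P - Q) :=
    (dvd_pow_self _ (by omega)).trans (pow_sub_dvd_iterate_derivative_of_pow_dvd j h)
  rw [dvd_iff_isRoot, IsRoot.def, iterate_derivative_sub, eval_sub, sub_eq_zero] at h1
  exact h1

open Polynomial in
/-- Hermite interpolation at two points. -/
lemma exists_polynomial_jet_jet {a b : ℂ} (hab : a ≠ b) (α β : ℕ → ℂ) (n : ℕ) :
    ∃ P : ℂ[X], ∀ j < n, (derivative^[j] P).eval a = α j ∧ (derivative^[j] P).eval b = β j := by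
  obtain ⟨A, -, hA⟩ := exists_polynomial_jet a α n
  obtain ⟨B, -, hB⟩ := exists_polynomial_jet b β n
  have hc : IsCoprime ((X - C a) ^ n) ((X - C b) ^ n) :=
    (isCoprime_X_sub_C_of_isUnit_sub (sub_ne_zero.2 hab).isUnit).pow
  obtain ⟨u, v, huv⟩ := hc
  -- Chinese remainder theorem: this is `A` modulo `(X - a)ⁿ`, and, since `u (X - a)ⁿ = 1 - v (X -
  -- b)ⁿ`, it is `B` modulo `(X - b)ⁿ`.
  refine ⟨A + u * (X - C a) ^ n * (B - A), fun j hj => ⟨?_, ?_⟩⟩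
  · rw [← hA j hj]
    exact eval_iterate_derivative_eq_of_pow_dvd hj ⟨u * (B - A), by ring⟩
  · rw [← hB j hj]
    exact eval_iterate_derivative_eq_of_pow_dvd hj
      ⟨v * (A - B), by linear_combination (B - A) * huv⟩

/-- The boundary values of the derivatives of order at most `n` of functions in `W₂ⁿ⁺¹` are
arbitrary. -/
lemma exists_hasTopDeriv_boundary {l : ℝ} (hl : 0 < l) (n : ℕ) (α β : ℕ → ℂ) :
    ∃ y g, HasTopDeriv l n y g ∧ ∀ j ≤ n, dv l j y 0 = α j ∧ dv l j y l = β j := by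
  have hne : (0 : ℂ) ≠ (l : ℂ) := by exact_mod_cast hl.ne
  obtain ⟨P, hP⟩ := exists_polynomial_jet_jet hne α β (n + 1)
  refine ⟨polyFun P, _, hasTopDeriv_polyFun hl n P, fun j hj => ?_⟩
  rw [dv_polyFun hl j P ⟨le_rfl, hl.le⟩, dv_polyFun hl j P ⟨hl.le, le_rfl⟩]
  obtain ⟨h1, h2⟩ := hP j (by omega)
  exact ⟨by simpa [polyFun] using h1, h2⟩

lemma HasTopDeriv.add {l : ℝ} (hl : 0 < l) {n : ℕ} {y z : ℝ → ℂ} {g h : L2 l}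
    (hy : HasTopDeriv l n y g) (hz : HasTopDeriv l n z h) :
    HasTopDeriv l n (y + z) (g + h) := by
  refine ⟨hy.contDiffOn.add hz.contDiffOn, fun x hx => ?_⟩
  rw [integral_congr (Lp.coeFn_add g h) hx, dv_add hl le_rfl hy.contDiffOn hz.contDiffOn hx,
    dv_add hl le_rfl hy.contDiffOn hz.contDiffOn ⟨le_rfl, hl.le⟩,
    hy.eq_integral x hx, hz.eq_integral x hx]
  simp only [Pi.add_apply]
  rw [intervalIntegral.integral_add (intervalIntegrable g hx) (intervalIntegrable h hx)]
  ring

/-! ### Orthogonality to polynomials of low degree. -/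

/-- The classes in `L²(0, l)` of the polynomials of degree at most `n`. -/
def polySpace (l : ℝ) (n : ℕ) : Submodule ℂ (L2 l) :=
  (Polynomial.degreeLT ℂ (n + 1)).map (polyL2 l)

/-- Finite dimension lets the space equal its double orthogonal complement. -/
instance (l : ℝ) (n : ℕ) : FiniteDimensional ℂ (polySpace l n) := by
  unfold polySpace
  infer_instance

/-- A function orthogonal to the polynomials of degree at most `2k` is the derivative of order
`2k + 1` of a function whose lower derivatives vanish at both end points. -/
lemma exists_hasTopDeriv_of_mem_orthogonal {l : ℝ} (hl : 0 < l) {k : ℕ} {g : L2 l}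
    (hg : g ∈ (polySpace l (2 * k))ᗮ) :
    ∃ y, HasTopDeriv l (2 * k) y g ∧ ∀ j ≤ 2 * k, dv l j y 0 = 0 ∧ dv l j y l = 0 := by
  obtain ⟨y, hy, h0⟩ := exists_hasTopDeriv hl (2 * k) g
  refine ⟨y, hy, fun j hj => ⟨h0 j hj, ?_⟩⟩
  -- `bdry` pairs `y⁽ʲ⁾` with the derivative of order `2k - j`. With this jet of `P` at `l`, the
  -- boundary form there reduces to `± y⁽ʲ⁾(l)`, while both inner products in Green's formula
  -- vanish.
  obtain ⟨P, hdeg, hP⟩ := exists_polynomial_jet (l : ℂ)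
    (fun i => if i = 2 * k - j then 1 else 0) (2 * k + 1)
  have hPtop := hasTopDeriv_polyFun hl (2 * k) P
  rw [Polynomial.iterate_derivative_eq_zero_of_degree_lt hdeg, map_zero] at hPtop
  have hin : inner ℂ (polyL2 l P) g = 0 :=
    hg _ (Submodule.mem_map_of_mem (Polynomial.mem_degreeLT.2 hdeg))
  have green := hy.inner_green hl hPtop
    (memLp_of_continuousOn hy.contDiffOn.continuousOn).coeFn_toLp (coeFn_polyL2 l P)
  have b0 : bdry l (2 * k) y (polyFun P) 0 = 0 :=
    Finset.sum_eq_zero fun i _ => by rw [h0 _ (Nat.sub_le _ _), zero_mul, mul_zero]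
  have bl : bdry l (2 * k) y (polyFun P) l = (-1) ^ (2 * k - j) * dv l j y l := by
    unfold bdry
    have hval : ∀ i < 2 * k + 1, dv l i (polyFun P) l = if i = 2 * k - j then 1 else 0 :=
      fun i hi => (dv_polyFun hl i P ⟨hl.le, le_rfl⟩).trans (hP i hi)
    rw [Finset.sum_eq_single (2 * k - j)]
    · rw [hval _ (by omega), if_pos rfl, star_one, mul_one, Nat.sub_sub_self hj]
    · intro i hi hne
      rw [hval i (Finset.mem_range.1 hi), if_neg hne, star_zero, mul_zero, mul_zero]
    · intro h
      exact absurd (Finset.mem_range.2 (by omega)) h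
  rw [hin, inner_zero_left, b0, bl, sub_zero, add_zero] at green
  exact (mul_eq_zero.1 green.symm).resolve_left (pow_ne_zero _ (by norm_num))

/-! ### The boundary form and the boundary conditions. -/

lemma J_mulVec (k : ℕ) (v : Fin k → ℂ) (r : Fin k) : (J k *ᵥ v) r = (-1) ^ (r : ℕ) * v r.rev := by
  simp only [Matrix.mulVec, dotProduct, J, Matrix.of_apply, ite_mul, zero_mul]
  rw [Finset.sum_eq_single r.rev]
  · rw [if_pos]
    rw [Fin.val_rev]
    omega
  · intro s _ hs
    rw [if_neg]
    intro h
    apply hs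
    ext
    rw [Fin.val_rev]
    omega
  · simp

/-- Reversal and signs make `J Y₁` exactly the vector that multiplies `Y₀` in `bdry`. -/
lemma J_mulVec_Y1 (l : ℝ) (k : ℕ) (y : ℝ → ℂ) (x : ℝ) (r : Fin k) :
    (J k *ᵥ Y1 l k y x) r = (-1) ^ (r : ℕ) * dv l (2 * k - r) y x := by
  rw [J_mulVec, Y1, Fin.val_rev]
  congr 2
  omega

/-- The boundary form in terms of the vectors `Y₀` and `Y₁`. -/
lemma bdry_eq (l : ℝ) (k : ℕ) (y z : ℝ → ℂ) (x : ℝ) :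
    bdry l (2 * k) y z x = (J k *ᵥ Y1 l k y x) ⬝ᵥ star (Y0 l k z x) +
      (-1) ^ k * (dv l k y x * star (dv l k z x)) +
      Y0 l k y x ⬝ᵥ star (J k *ᵥ Y1 l k z x) := by
  have e : 2 * k + 1 = k + 1 + k := by omega
  unfold bdry
  rw [e, Finset.sum_range_add, Finset.sum_range_succ]
  have hk : 2 * k - k = k := by omega
  rw [hk]
  congr 1
  · congr 1
    rw [Finset.sum_range]
    refine Finset.sum_congr rfl fun r _ => ?_
    rw [J_mulVec_Y1, Pi.star_apply, Y0]
    ring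
  -- The terms `j > k` are indexed by `j = 2k - r`, where `r < k`; `j` and `r` have the same parity.
  · rw [← Finset.sum_range_reflect, Finset.sum_range]
    refine Finset.sum_congr rfl fun r _ => ?_
    rw [Pi.star_apply, J_mulVec_Y1, Y0, star_mul']
    have hr := r.2
    have h1 : k + 1 + (k - 1 - (r : ℕ)) = 2 * k - r := by omega
    have h2 : 2 * k - (2 * k - (r : ℕ)) = r := by omega
    have h3 : (-1 : ℂ) ^ (2 * k - (r : ℕ)) = (-1) ^ (r : ℕ) := by
      have : 2 * k - (r : ℕ) = 2 * (k - r) + r := by omega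
      rw [this, pow_add, pow_mul, neg_one_sq, one_pow, one_mul]
    have h4 : star ((-1 : ℂ) ^ (r : ℕ)) = (-1) ^ (r : ℕ) := by
      rw [star_pow, star_neg, star_one]
    rw [h1, h2, h3, h4]
    ring

/-- `iB` is skew-Hermitian when `B` is Hermitian. -/
lemma dotProduct_add_dotProduct_hermitian {k : ℕ} {B : Matrix (Fin k) (Fin k) ℂ}
    (hB : B.IsHermitian) (u v : Fin k → ℂ) :
    (Complex.I • (B *ᵥ u)) ⬝ᵥ star v + u ⬝ᵥ star (Complex.I • (B *ᵥ v)) = 0 := by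
  have h : (B *ᵥ u) ⬝ᵥ star v = u ⬝ᵥ star (B *ᵥ v) := by
    rw [Matrix.star_mulVec, hB.eq, dotProduct_comm, Matrix.dotProduct_mulVec, dotProduct_comm]
  rw [star_smul, smul_dotProduct, dotProduct_smul, h]
  simp

/-- The boundary form vanishes on functions that satisfy the boundary conditions. -/
lemma BoundaryConditions.bdry_eq_bdry {l : ℝ} {k : ℕ} {θ : ℂ} (hθ : ‖θ‖ = 1)
    {B₀ Bl : Matrix (Fin k) (Fin k) ℂ} (hB₀ : B₀.IsHermitian) (hBl : Bl.IsHermitian)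
    {y z : ℝ → ℂ} (hy : BoundaryConditions l k θ B₀ Bl y)
    (hz : BoundaryConditions l k θ B₀ Bl z) :
    bdry l (2 * k) y z l = bdry l (2 * k) y z 0 := by
  have h0 := dotProduct_add_dotProduct_hermitian hB₀ (Y0 l k y 0) (Y0 l k z 0)
  have hl := dotProduct_add_dotProduct_hermitian hBl (Y0 l k y l) (Y0 l k z l)
  have hm : θ * star θ = 1 := by
    have := Complex.mul_conj' θ
    rw [hθ] at this
    simpa using this
  rw [bdry_eq, bdry_eq, hy.left, hy.right, hz.left, hz.right, hy.middle, hz.middle, star_mul']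
  linear_combination hl - h0 + (-1) ^ k * dv l k y 0 * star (dv l k z 0) * hm

/-- The sequence of boundary values with prescribed `Y₀ = a`, `y⁽ᵏ⁾ = m`, `J Y₁ = b`. -/
def boundaryData {k : ℕ} (a b : Fin k → ℂ) (m : ℂ) (j : ℕ) : ℂ :=
  -- The middle branch inverts `(J Y₁)ᵣ = (-1)ʳ y⁽²ᵏ⁻ʳ⁾` at `r = 2k - j`; `j = k` falls to `m`.
  -- Values for `j > 2k` are never used.
  if h : j < k then a ⟨j, h⟩ else if h' : 2 * k - j < k then (-1) ^ j * b ⟨2 * k - j, h'⟩ else m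

lemma boundaryData_spec {l : ℝ} {k : ℕ} {a b : Fin k → ℂ} {m : ℂ} {y : ℝ → ℂ} {x : ℝ}
    (h : ∀ j ≤ 2 * k, dv l j y x = boundaryData a b m j) :
    Y0 l k y x = a ∧ J k *ᵥ Y1 l k y x = b ∧ dv l k y x = m := by
  refine ⟨funext fun r => ?_, funext fun r => ?_, ?_⟩
  · rw [Y0, h _ (by omega), boundaryData, dif_pos r.2]
  · have hr := r.2
    have e : 2 * k - (2 * k - (r : ℕ)) = r := by omega
    rw [J_mulVec_Y1, h _ (Nat.sub_le _ _), boundaryData, dif_neg (by omega), dif_pos (by omega)]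
    simp only [e]
    rw [← mul_assoc, ← pow_add, Even.neg_one_pow, one_mul]
    exact ⟨k, by omega⟩
  · rw [h _ (by omega), boundaryData, dif_neg (by omega), dif_neg (by omega)]

/-- The boundary values `Y₀`, `J Y₁` and `y⁽ᵏ⁾` at the two end points are arbitrary. -/
lemma exists_hasTopDeriv_boundaryVectors {l : ℝ} (hl : 0 < l) {k : ℕ} (a₀ b₀ al bl : Fin k → ℂ)
    (m₀ ml : ℂ) : ∃ y g, HasTopDeriv l (2 * k) y g ∧
      (Y0 l k y 0 = a₀ ∧ J k *ᵥ Y1 l k y 0 = b₀ ∧ dv l k y 0 = m₀) ∧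
      (Y0 l k y l = al ∧ J k *ᵥ Y1 l k y l = bl ∧ dv l k y l = ml) := by
  obtain ⟨y, g, hy, h⟩ := exists_hasTopDeriv_boundary hl (2 * k)
    (boundaryData a₀ b₀ m₀) (boundaryData al bl ml)
  exact ⟨y, g, hy, boundaryData_spec fun j hj => (h j hj).1,
    boundaryData_spec fun j hj => (h j hj).2⟩

/-- `iBv` satisfies the same identity for every `u`, and the pairing is nondegenerate. -/
lemma eq_of_dotProduct_hermitian {k : ℕ} {B : Matrix (Fin k) (Fin k) ℂ}
    (hB : B.IsHermitian) {v w : Fin k → ℂ}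
    (h : ∀ u : Fin k → ℂ, (Complex.I • (B *ᵥ u)) ⬝ᵥ star v + u ⬝ᵥ star w = 0) :
    w = Complex.I • (B *ᵥ v) := by
  rw [← star_inj]
  refine dotProduct_eq _ _ fun u => ?_
  have h1 := h u
  have h2 := dotProduct_add_dotProduct_hermitian hB u v
  rw [dotProduct_comm, dotProduct_comm _ u]
  linear_combination h1 - h2

/-- A function whose boundary form with all functions satisfying the boundary conditions vanishes
satisfies the boundary conditions. -/
lemma boundaryConditions_of_bdry {l : ℝ} (hl : 0 < l) {k : ℕ} {θ : ℂ} (hθ : ‖θ‖ = 1)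
    {B₀ Bl : Matrix (Fin k) (Fin k) ℂ} (hB₀ : B₀.IsHermitian) (hBl : Bl.IsHermitian)
    {z : ℝ → ℂ}
    (H : ∀ (y : ℝ → ℂ) (g : L2 l), HasTopDeriv l (2 * k) y g →
      BoundaryConditions l k θ B₀ Bl y → bdry l (2 * k) y z l = bdry l (2 * k) y z 0) :
    BoundaryConditions l k θ B₀ Bl z := by
  -- `a = Y₀(0)`, `b = Y₀(l)` and `m = y⁽ᵏ⁾(0)` are the free parameters of the boundary conditions;
  -- varying one at a time isolates each condition on `z`.
  have key : ∀ (a b : Fin k → ℂ) (m : ℂ),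
      (Complex.I • (Bl *ᵥ b)) ⬝ᵥ star (Y0 l k z l) + (-1) ^ k * (θ * m * star (dv l k z l)) +
        b ⬝ᵥ star (J k *ᵥ Y1 l k z l) =
      (Complex.I • (B₀ *ᵥ a)) ⬝ᵥ star (Y0 l k z 0) + (-1) ^ k * (m * star (dv l k z 0)) +
        a ⬝ᵥ star (J k *ᵥ Y1 l k z 0) := by
    intro a b m
    obtain ⟨y, g, hy, ⟨e1, e2, e3⟩, ⟨e4, e5, e6⟩⟩ := exists_hasTopDeriv_boundaryVectors hl
      a (Complex.I • (B₀ *ᵥ a)) b (Complex.I • (Bl *ᵥ b)) m (θ * m)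
    have h := H y g hy ⟨by rw [e3, e6], by rw [e1, e2], by rw [e4, e5]⟩
    rwa [bdry_eq, bdry_eq, e1, e2, e3, e4, e5, e6] at h
  refine ⟨?_, ?_, ?_⟩
  -- This gives `θ conj z⁽ᵏ⁾(l) = conj z⁽ᵏ⁾(0)`; conjugate and multiply by `θ`.
  · have h := key 0 0 1
    simp only [Matrix.mulVec_zero, smul_zero, zero_dotProduct, zero_add, add_zero, mul_one,
      one_mul] at h
    have h' := mul_left_cancel₀ (pow_ne_zero k (by norm_num)) h
    have hm : star θ * θ = 1 := by
      have := Complex.conj_mul' θ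
      rw [hθ] at this
      simpa using this
    have h2 := congrArg star h'
    rw [star_mul', star_star, star_star] at h2
    rw [← h2]
    linear_combination -dv l k z l * hm
  · refine eq_of_dotProduct_hermitian hB₀ fun u => ?_
    simpa using (key u 0 0).symm
  · refine eq_of_dotProduct_hermitian hBl fun u => ?_
    simpa using key 0 u 0

/-! ### The adjoint relation and density. -/

/-- This sign change turns the skew-symmetry in `inner_green` into symmetry of the operator. -/
lemma conj_negI_pow (k : ℕ) :
    (starRingEnd ℂ) ((-Complex.I) ^ (2 * k + 1)) = -(-Complex.I) ^ (2 * k + 1) := by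
  rw [map_pow, map_neg, Complex.conj_I, Odd.neg_pow ⟨k, rfl⟩]

lemma negI_pow_ne_zero (k : ℕ) : (-Complex.I) ^ (2 * k + 1) ≠ 0 :=
  pow_ne_zero _ (neg_ne_zero.2 Complex.I_ne_zero)

/-- The adjoint relation of the graph is the graph itself. -/
lemma adjoint_operatorGraph {l : ℝ} (hl : 0 < l) {k : ℕ} {θ : ℂ} (hθ : ‖θ‖ = 1)
    {B₀ Bl : Matrix (Fin k) (Fin k) ℂ} (hB₀ : B₀.IsHermitian) (hBl : Bl.IsHermitian) :
    (operatorGraph hl k θ B₀ Bl).adjoint = operatorGraph hl k θ B₀ Bl := by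
  set c : ℂ := (-Complex.I) ^ (2 * k + 1) with hc
  have hc0 : c ≠ 0 := negI_pow_ne_zero k
  have hcc : (starRingEnd ℂ) c = -c := conj_negI_pow k
  ext ⟨Z, W⟩
  rw [Submodule.mem_adjoint_iff]
  constructor
  · intro H
    set h : L2 l := c⁻¹ • W with hh
    have hW : W = c • h := by rw [hh, smul_smul, mul_inv_cancel₀ hc0, one_smul]
    -- Cancelling the factor `c` puts membership in the adjoint relation into the form of the left
    -- side of Green's formula.
    have H' : ∀ (Y : L2 l) (y : ℝ → ℂ) (g : L2 l), HasTopDeriv l (2 * k) y g →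
        BoundaryConditions l k θ B₀ Bl y → Y =ᵐ[volume.restrict (Ioo 0 l)] y →
        inner ℂ Z g + inner ℂ h Y = 0 := by
      intro Y y g hy hb e
      have h1 : inner ℂ (c • g) Z - inner ℂ Y W = 0 := H Y (c • g) ⟨y, g, hy, hb, e, rfl⟩
      rw [hW, inner_smul_left, inner_smul_right, hcc] at h1
      have h2 : inner ℂ g Z + inner ℂ Y h = 0 := by
        have : c * (inner ℂ g Z + inner ℂ Y h) = 0 := by linear_combination -h1
        exact (mul_eq_zero.1 this).resolve_left hc0
      have h3 := congrArg (starRingEnd ℂ) h2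
      rwa [map_add, inner_conj_symm, inner_conj_symm, map_zero] at h3
    obtain ⟨z₀, hz₀, -⟩ := exists_hasTopDeriv hl (2 * k) h
    set Z₀ : L2 l := (memLp_of_continuousOn hz₀.contDiffOn.continuousOn).toLp
    have eZ₀ : Z₀ =ᵐ[volume.restrict (Ioo 0 l)] z₀ :=
      (memLp_of_continuousOn hz₀.contDiffOn.continuousOn).coeFn_toLp
    have hmem : Z - Z₀ ∈ polySpace l (2 * k) := by
      rw [← Submodule.orthogonal_orthogonal (polySpace l (2 * k)), Submodule.mem_orthogonal']
      intro g hg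
      obtain ⟨y, hy, h0⟩ := exists_hasTopDeriv_of_mem_orthogonal hl hg
      have eY := (memLp_of_continuousOn hy.contDiffOn.continuousOn).coeFn_toLp
      have Y00 : Y0 l k y 0 = 0 := funext fun r => (h0 _ (by omega)).1
      have Y0l : Y0 l k y l = 0 := funext fun r => (h0 _ (by omega)).2
      have Y10 : Y1 l k y 0 = 0 := funext fun r => (h0 _ (by omega)).1
      have Y1l : Y1 l k y l = 0 := funext fun r => (h0 _ (by omega)).2
      have h1 := H' _ y g hy ⟨by rw [(h0 k (by omega)).1, (h0 k (by omega)).2, mul_zero],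
        by simp [Y00, Y10], by simp [Y0l, Y1l]⟩ eY
      have h2 := hy.inner_green hl hz₀ eY eZ₀
      have b0 : bdry l (2 * k) y z₀ 0 = 0 :=
        Finset.sum_eq_zero fun i _ => by rw [(h0 _ (Nat.sub_le _ _)).1, zero_mul, mul_zero]
      have bl : bdry l (2 * k) y z₀ l = 0 :=
        Finset.sum_eq_zero fun i _ => by rw [(h0 _ (Nat.sub_le _ _)).2, zero_mul, mul_zero]
      rw [b0, bl] at h2
      rw [inner_sub_left]
      linear_combination h1 - h2
    -- Adding a polynomial of degree at most `2k` to `z₀` leaves its top derivative `h` unchanged.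
    obtain ⟨P, hP, hPZ⟩ := Submodule.mem_map.1 hmem
    have hPtop := hasTopDeriv_polyFun hl (2 * k) P
    rw [Polynomial.iterate_derivative_eq_zero_of_degree_lt (Polynomial.mem_degreeLT.1 hP),
      map_zero] at hPtop
    have hz := hz₀.add hl hPtop
    rw [add_zero] at hz
    have eZ : Z =ᵐ[volume.restrict (Ioo 0 l)] z₀ + polyFun P := by
      have : Z = Z₀ + polyL2 l P := by rw [hPZ]; abel
      rw [this]
      exact (Lp.coeFn_add _ _).trans (eZ₀.add (coeFn_polyL2 l P))
    refine ⟨z₀ + polyFun P, h, hz, boundaryConditions_of_bdry hl hθ hB₀ hBl ?_, eZ, hW⟩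
    intro y g hy hb
    have eY := (memLp_of_continuousOn hy.contDiffOn.continuousOn).coeFn_toLp
    have h1 := H' _ y g hy hb eY
    have h2 := hy.inner_green hl hz eY eZ
    linear_combination h1 - h2
  -- Symmetry: the boundary terms in Green's formula cancel.
  · rintro ⟨z, h, hz, hbz, eZ, hW⟩ Y V ⟨y, g, hy, hby, eY, hV⟩
    simp only at hW hV eZ eY
    have h1 := hz.inner_green hl hy eZ eY
    rw [hbz.bdry_eq_bdry hθ hB₀ hBl hby, sub_self] at h1
    rw [hW, hV, inner_smul_left, inner_smul_right, ← hc, hcc]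
    linear_combination -c * h1

/-- The adjoint relation of a graph makes sense without density. If `h` is orthogonal to the domain,
then `(0, h)` lies in the adjoint relation, which is the graph itself, and single-valuedness gives
`h = 0`. -/
lemma operator_domain_dense {l : ℝ} (hl : 0 < l) {k : ℕ} {θ : ℂ} (hθ : ‖θ‖ = 1)
    {B₀ Bl : Matrix (Fin k) (Fin k) ℂ} (hB₀ : B₀.IsHermitian) (hBl : Bl.IsHermitian) :
    Dense ((operator hl k θ B₀ Bl).domain : Set (L2 l)) := by
  rw [Submodule.dense_iff_topologicalClosure_eq_top, Submodule.topologicalClosure_eq_top_iff,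
    Submodule.eq_bot_iff]
  intro h hh
  refine operatorGraph_single_valued hl k θ B₀ Bl (0, h) ?_ rfl
  rw [← adjoint_operatorGraph hl hθ hB₀ hBl, Submodule.mem_adjoint_iff]
  intro a b hab
  rw [← operator_graph] at hab
  have ha : a ∈ (operator hl k θ B₀ Bl).domain := LinearPMap.mem_domain_of_mem_graph hab
  simp [hh a ha]

end OddOrder

end

theorem proposition7p3 (k : ℕ) (l : ℝ) (hl : 0 < l) (θ : ℂ) (hθ : ‖θ‖ = 1)
    (B₀ Bl : Matrix (Fin k) (Fin k) ℂ) (hB₀ : B₀.IsHermitian) (hBl : Bl.IsHermitian) :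
    Dense ((OddOrder.operator hl k θ B₀ Bl).domain : Set (OddOrder.L2 l)) ∧
      IsSelfAdjoint (OddOrder.operator hl k θ B₀ Bl) := by
  have hd := OddOrder.operator_domain_dense hl hθ hB₀ hBl
  refine ⟨hd, LinearPMap.isSelfAdjoint_def.2 (LinearPMap.eq_of_eq_graph ?_)⟩
  rw [LinearPMap.adjoint_graph_eq_graph_adjoint hd, OddOrder.operator_graph,
    OddOrder.adjoint_operatorGraph hl hθ hB₀ hBl]
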